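/- All graphs are finite and simple. Given a set $S$ of initially colored vertices of a graph $G=(V,E)$, a colored vertex with exactly one uncolored neighbor forces that neighbor to become colored; $S$ is a zero forcing set if repeated application of this rule colors all of $V$. A connected forcing set is a zero forcing set which induces a connected subgraph, and the connected forcing number $Z_c(G)$ is the minimum cardinality of a connected forcing set (a disconnected graph has none). A leaf is a vertex of degree 1. $G$ is a graph of two parallel paths if $G$ is not a path and $V$ can be partitioned into nonempty sets $V_1,V_2$ such that $P=G[V_1]$ and $Q=G[V_2]$ are paths and $G$ has a standard drawing: one in the plane in which $P$ and $Q$ are parallel line segments and the edges between $V_1$ and $V_2$ (cross edges), drawn as straight line segments, do not cross. In a standard drawing, let $a_0,\dots,a_p$ and $b_0,\dots,b_q$ ($p,q\ge 0$) be the vertices of $P$ and of $Q$, in order along the paths, both in the same direction. The sets $\{a_0,b_0\}$ and $\{a_p,b_q\}$ are called the ends. Theorem. $Z_c(G)=2$ if and only if $G$ is a graph of two parallel paths that belongs to at least one of the following two families. 1. $G$ has a standard drawing in which all leaves of $G$ (if any; so there are 0, 1 or 2) belong to the end $\{a_p,b_q\}$, and for some $(i,j)\neq(0,0)$ with $0\le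 i\le p$ and $0\le j\le q$, $a_0b_0$ and $a_ib_j$ are edges and every cross edge joins one of $a_0,\dots,a_i$ to one of $b_0,\dots,b_j$. (The other cross edges are arbitrary, subject to not crossing; the vertices after $a_i$ and those after $b_j$ form pendant paths, possibly empty.) 2. $G$ has a standard drawing in which $G$ has exactly two leaves, $a_0$ and $a_p$, with $p\ge1$, and for some $i$ with $0\le i<p$, $a_ib_0$ and $a_{i+1}b_q$ are edges and all cross edges other than $a_ib_0$ are incident to $a_{i+1}$. (The vertices before $a_i$ and those after $a_{i+1}$ form pendant paths.) -/

import Mathlib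

/-! Zero forcing, connected forcing, and graphs of two parallel paths. -/

namespace ConnectedForcing

universe u

/-- The derived set of `S`: the smallest set containing `S` and closed under the colour change
rule, by which a coloured vertex `u` all of whose neighbours other than `v` are coloured forces
its neighbour `v`. -/
inductive Derived {V : Type u} (G : SimpleGraph V) (S : Set V) : V → Prop
  | initial (v : V) (hv : v ∈ S) : Derived G S v
  | force (u v : V) (hu : Derived G S u) (huv : G.Adj u v)
      (h : ∀ w, G.Adj u w → w ≠ v → Derived G S w) : Derived G S v

/-- `S` is a zero forcing set: its derived set consists of all vertices. -/
def IsZeroForcing {V : Type u} (G : SimpleGraph V) (S : Set V) : Prop :=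
  ∀ v, Derived G S v

/-- `S` is a connected (zero) forcing set: it is zero forcing and induces a connected subgraph
(connected graphs are nonempty). -/
def IsConnectedForcing {V : Type u} (G : SimpleGraph V) (S : Set V) : Prop :=
  IsZeroForcing G S ∧ (G.induce S).Connected

/-- The connected forcing number `Z_c(G)`, the least cardinality of a connected forcing set; it is
`⊤` if there is none (for instance if `G` is disconnected). -/
noncomputable def connectedForcingNumber {V : Type u} (G : SimpleGraph V) : ℕ∞ :=
  ⨅ S : {S : Set V // IsConnectedForcing G S}, S.1.encard

/-- A leaf is a vertex of degree one. -/
def IsLeaf {V : Type u} (G : SimpleGraph V) (v : V) : Prop :=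
  ∃! w, G.Adj v w

/-- `G` is isomorphic to a path `P_n`. -/
def IsPathGraph {V : Type u} (G : SimpleGraph V) : Prop :=
  ∃ n : ℕ, Nonempty (G ≃g SimpleGraph.pathGraph n)

/-- A standard drawing of `G`. The vertex set is partitioned into two nonempty sets (the ranges of
`P` and `Q`), each of which induces a path, enumerated by `P` and `Q` respectively (an embedding
`↪g` is an isomorphism onto an induced subgraph). The path `P` is drawn on the line of points with
second coordinate `0` and the path `Q` on the parallel line of points with second coordinate `1`,
both increasing in the same direction, in such a way that the edges between the two paths, drawn
as straight line segments, do not cross. -/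
structure StandardDrawing {V : Type u} (G : SimpleGraph V) where
  /-- the length (number of edges) of the first path -/
  p : ℕ
  /-- the length (number of edges) of the second path -/
  q : ℕ
  /-- the vertices of the first path, in order -/
  P : SimpleGraph.pathGraph (p + 1) ↪g G
  /-- the vertices of the second path, in order -/
  Q : SimpleGraph.pathGraph (q + 1) ↪g G
  partition : IsCompl (Set.range P) (Set.range Q)
  /-- positions of the vertices of the first path on its line -/
  x : Fin (p + 1) → ℝ
  /-- positions of the vertices of the second path on its line -/
  y : Fin (q + 1) → ℝ
  x_strictMono : StrictMono x
  y_strictMono : StrictMono y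
  noncrossing : ∀ (i i' : Fin (p + 1)) (j j' : Fin (q + 1)),
    G.Adj (P i) (Q j) → G.Adj (P i') (Q j') → (i, j) ≠ (i', j') →
      Disjoint (openSegment ℝ ((x i, 0) : ℝ × ℝ) (y j, 1))
        (openSegment ℝ ((x i', 0) : ℝ × ℝ) (y j', 1))

/-- `G` is a graph of two parallel paths: it is not a path and it has a standard drawing. -/
def IsGraphOfTwoParallelPaths {V : Type u} (G : SimpleGraph V) : Prop :=
  ¬ IsPathGraph G ∧ Nonempty (StandardDrawing G)

/-- The first family. In some standard drawing the two first vertices are adjacent, the vertices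
`P i` and `Q j` are adjacent, these two mandatory edges are distinct, and every edge between the
two paths joins one of `P 0, …, P i` to one of `Q 0, …, Q j` (so that the vertices after `P i` on
the first path, and those after `Q j` on the second path, form pendant paths, possibly empty).
The leaves of `G`, if any, belong to one end `{last P, last Q}` of the drawing. -/
def InFirstFamily {V : Type u} (G : SimpleGraph V) : Prop :=
  IsGraphOfTwoParallelPaths G ∧
  ∃ (D : StandardDrawing G) (i : Fin (D.p + 1)) (j : Fin (D.q + 1)),
    (∀ v, IsLeaf G v → v = D.P (Fin.last D.p) ∨ v = D.Q (Fin.last D.q)) ∧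
    G.Adj (D.P 0) (D.Q 0) ∧
    G.Adj (D.P i) (D.Q j) ∧
    (i, j) ≠ (0, 0) ∧
    ∀ (k : Fin (D.p + 1)) (l : Fin (D.q + 1)), G.Adj (D.P k) (D.Q l) → k ≤ i ∧ l ≤ j

/-- The second family. In some standard drawing `G` has exactly two leaves, the first and the last
vertex of the path `P`, and there are consecutive vertices `P i`, `P i'` of this path such that
`P i` is adjacent to the first vertex of `Q`, `P i'` is adjacent to the last vertex of `Q`, and
all other edges between the two paths are incident to `P i'` (which of the two vertices plays this
role is a matter of the direction in which the paths are read). The vertices of `P` before `P i`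
and those after `P i'` form pendant paths. -/
def InSecondFamily {V : Type u} (G : SimpleGraph V) : Prop :=
  IsGraphOfTwoParallelPaths G ∧
  ∃ (D : StandardDrawing G) (i i' : Fin (D.p + 1)),
    (∀ v, IsLeaf G v ↔ v = D.P 0 ∨ v = D.P (Fin.last D.p)) ∧
    i'.val = i.val + 1 ∧
    G.Adj (D.P i) (D.Q 0) ∧
    G.Adj (D.P i') (D.Q (Fin.last D.q)) ∧
    ∀ (k : Fin (D.p + 1)) (l : Fin (D.q + 1)),
      G.Adj (D.P k) (D.Q l) → (k = i ∧ l = 0) ∨ k = i'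

end ConnectedForcing

namespace ConnectedForcing

/-! Following the forces started by a coloured set splits the vertices into chains. A single forcing
vertex gives one chain, so `G` is a path (`IsZeroForcing.isPathGraph`). Hence `Z_c(G) = 2` means
that `G` is not a path and some adjacent pair forces.

For such a pair the two chains are induced paths, and a force is only possible when no other
neighbour is uncoloured, which prevents crossings (`exists_isForcingPair`). This is a standard
drawing whose first vertices are adjacent. Its cross edges are totally ordered, so a greatest one
exists; were it `a_0 b_0`, the last vertex of `P` would force alone (`isZeroForcing_last`). So the
first family always results, and it contains the second.

Conversely, in any standard drawing the first end forces (`isZeroForcing_first`); in the second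
family the pair `a_{i+1}, b_q` does (`isZeroForcing_second`). -/

variable {V : Type*} {G : SimpleGraph V}

/-! ### Forcing chains -/

/-- The vertices `a 0, …, a s` are distinct and induce a path, in this order. -/
structure IsInducedPath (G : SimpleGraph V) (a : ℕ → V) (s : ℕ) : Prop where
  inj : ∀ k ≤ s, ∀ l ≤ s, a k = a l → k = l
  adj : ∀ k ≤ s, ∀ l ≤ s, (G.Adj (a k) (a l) ↔ k + 1 = l ∨ l + 1 = k)

/-- An induced path `a 0, …, a s` inside `C` such that all neighbours of its vertices other than
the last one belong to `C`. -/
structure IsForcingChain (G : SimpleGraph V) (a : ℕ → V) (s : ℕ) (C : Set V) : Prop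
    extends IsInducedPath G a s where
  mem : ∀ k ≤ s, a k ∈ C
  nbr : ∀ k < s, ∀ w, G.Adj (a k) w → w ∈ C

namespace IsForcingChain

variable {a : ℕ → V} {s : ℕ} {C : Set V}

lemma mono (h : IsForcingChain G a s C) {C' : Set V} (hC : C ⊆ C') : IsForcingChain G a s C' :=
  ⟨h.toIsInducedPath, fun k hk => hC (h.mem k hk), fun k hk w hw => hC (h.nbr k hk w hw)⟩

lemma const (u : V) {C : Set V} (hu : u ∈ C) : IsForcingChain G (fun _ => u) 0 C where
  inj := by intros; omega
  adj k hk l hl := by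
    have : ¬ (k + 1 = l ∨ l + 1 = k) := by omega
    simp [this]
  mem _ _ := hu
  nbr := by intros; omega

/-- Earlier vertices of the chain have all their neighbours in `C`, so `w ∉ C` is adjacent to none
of them and the longer path is still induced. -/
lemma update (h : IsForcingChain G a s C) {w : V} (hw : w ∉ C) (haw : G.Adj (a s) w)
    (hn : ∀ x, G.Adj (a s) x → x ≠ w → x ∈ C) :
    IsForcingChain G (Function.update a (s + 1) w) (s + 1) (insert w C) := by
  have hlt : ∀ k, k ≤ s → Function.update a (s + 1) w k = a k := fun k hk =>
    Function.update_of_ne (by omega) _ _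
  have hself : Function.update a (s + 1) w (s + 1) = w := Function.update_self _ _ _
  have hadj : ∀ k ≤ s, (G.Adj (a k) w ↔ k = s) := fun k hk => by
    refine ⟨fun hkw => ?_, fun hks => hks ▸ haw⟩
    by_contra hne
    exact hw (h.nbr k (by omega) w hkw)
  refine ⟨⟨fun k hk l hl hkl => ?_, fun k hk l hl => ?_⟩, fun k hk => ?_, fun k hk x hx => ?_⟩
  · rcases Nat.le_succ_iff.1 hk with hk | rfl <;> rcases Nat.le_succ_iff.1 hl with hl | rfl
    · rw [hlt k hk, hlt l hl] at hkl
      exact h.inj k hk l hl hkl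
    · rw [hlt k hk, hself] at hkl
      exact absurd (hkl ▸ h.mem k hk) hw
    · rw [hlt l hl, hself] at hkl
      exact absurd (hkl ▸ h.mem l hl) hw
    · rfl
  · rcases Nat.le_succ_iff.1 hk with hk | rfl <;> rcases Nat.le_succ_iff.1 hl with hl | rfl
    · rw [hlt k hk, hlt l hl]
      exact h.adj k hk l hl
    · rw [hlt k hk, hself, hadj k hk]
      omega
    · rw [hlt l hl, hself, G.adj_comm, hadj l hl]
      omega
    · simp
  · rcases Nat.le_succ_iff.1 hk with hk | rfl
    · rw [hlt k hk]
      exact Or.inr (h.mem k hk)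
    · rw [hself]
      exact Or.inl rfl
  · rw [hlt k (by omega)] at hx
    rcases Nat.lt_succ_iff_lt_or_eq.1 hk with hk | rfl
    · exact Or.inr (h.nbr k hk x hx)
    · by_cases hxw : x = w
      · exact Or.inl hxw
      · exact Or.inr (hn x hx hxw)

end IsForcingChain

/-- The embedding of the path graph given by an induced path. -/
def IsInducedPath.embedding {a : ℕ → V} {s : ℕ} (h : IsInducedPath G a s) :
    SimpleGraph.pathGraph (s + 1) ↪g G where
  toFun k := a k
  inj' k l hkl := Fin.ext (h.inj k (by omega) l (by omega) hkl)
  map_rel_iff' {k l} := by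
    rw [SimpleGraph.pathGraph_adj]
    exact h.adj k (by omega) l (by omega)

/-- An embedded path graph, enumerated by natural numbers (constant after the last vertex). -/
def pathFun {p : ℕ} (P : SimpleGraph.pathGraph (p + 1) ↪g G) (k : ℕ) : V :=
  P ⟨min k p, by omega⟩

lemma pathFun_val {p : ℕ} (P : SimpleGraph.pathGraph (p + 1) ↪g G) (k : Fin (p + 1)) :
    pathFun P k = P k := by
  unfold pathFun
  congr
  omega

lemma isInducedPath_pathFun {p : ℕ} (P : SimpleGraph.pathGraph (p + 1) ↪g G) :
    IsInducedPath G (pathFun P) p where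
  inj k hk l hl h := by
    have := Fin.val_eq_of_eq (P.injective h)
    simp only at this
    omega
  adj k hk l hl := by
    unfold pathFun
    rw [P.map_adj_iff, SimpleGraph.pathGraph_adj]
    simp only [min_eq_left hk, min_eq_left hl]

/-! ### Forcing from a single vertex -/

/-- If `C` contains `S`, which is zero forcing, but not all vertices, then some vertex of `C` can
force a vertex outside `C`. -/
lemma IsZeroForcing.exists_force {S C : Set V} (hS : IsZeroForcing G S) (hSC : S ⊆ C)
    {v : V} (hv : v ∉ C) :
    ∃ x ∈ C, ∃ w ∉ C, G.Adj x w ∧ ∀ y, G.Adj x y → y ≠ w → y ∈ C := by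
  by_contra! hcon
  refine hv ?_
  induction hS v with
  | initial v hv' => exact hSC hv'
  | force x w _ hxw _ ihx ih =>
    by_contra hw
    obtain ⟨y, hxy, hyw, hy⟩ := hcon x (by_contra fun hx => hx (ihx hx)) w hw hxw
    exact hy (by_contra fun hy' => hy' (ih y hxy hyw hy'))

lemma exists_chain_of_singleton [Finite V] {u : V} (hu : IsZeroForcing G {u}) :
    ∃ a s, IsForcingChain G a s Set.univ ∧ ∀ v, ∃ k ≤ s, a k = v := by
  -- Here `C` is the set coloured so far, and the induction is on the number of vertices outside it.
  -- Only the end of the chain can force.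
  suffices H : ∀ n, ∀ (a : ℕ → V) (s : ℕ) (C : Set V), Cᶜ.ncard = n → u ∈ C →
      IsForcingChain G a s C → (∀ v ∈ C, ∃ k ≤ s, a k = v) →
      ∃ a s, IsForcingChain G a s Set.univ ∧ ∀ v, ∃ k ≤ s, a k = v by
    refine H _ (fun _ => u) 0 {u} rfl rfl (.const u rfl) ?_
    rintro v rfl
    exact ⟨0, le_rfl, rfl⟩
  intro n
  induction n using Nat.strong_induction_on with
  | _ n ih =>
    intro a s C hn huC hc hcov
    by_cases hC : ∀ v, v ∈ C
    · exact ⟨a, s, hc.mono (Set.subset_univ _), fun v => hcov v (hC v)⟩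
    push Not at hC
    obtain ⟨v, hv⟩ := hC
    obtain ⟨x, hx, w, hw, hxw, hn'⟩ := hu.exists_force (Set.singleton_subset_iff.2 huC) hv
    obtain ⟨k, hk, rfl⟩ := hcov x hx
    obtain rfl : k = s := by
      by_contra hks
      exact hw (hc.nbr k (by omega) w hxw)
    refine ih _ ?_ _ _ _ rfl (Or.inr huC) (hc.update hw hxw hn') ?_
    · rw [← hn]
      refine Set.ncard_lt_ncard ⟨fun y hy hyC => hy (Or.inr hyC), fun h => ?_⟩ (Set.toFinite _)
      exact h hw (Or.inl rfl)
    · rintro y (rfl | hy)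
      · exact ⟨k + 1, le_rfl, Function.update_self _ _ _⟩
      · obtain ⟨l, hl, rfl⟩ := hcov y hy
        exact ⟨l, by omega, Function.update_of_ne (by omega) _ _⟩

lemma IsZeroForcing.isPathGraph [Finite V] {u : V} (hu : IsZeroForcing G {u}) :
    IsPathGraph G := by
  obtain ⟨a, s, hc, hcov⟩ := exists_chain_of_singleton hu
  refine ⟨s + 1, ⟨(RelIso.ofSurjective hc.toIsInducedPath.embedding fun v => ?_).symm⟩⟩
  obtain ⟨k, hk, rfl⟩ := hcov v
  exact ⟨⟨k, by omega⟩, rfl⟩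

/-- Forcing along a sequence of vertices. -/
lemma derived_of_sequence {S : Set V} (f : ℕ → V) (n : ℕ) (h0 : Derived G S (f 0))
    (hadj : ∀ k < n, G.Adj (f k) (f (k + 1)))
    (hn : ∀ k < n, ∀ w, G.Adj (f k) w → w ≠ f (k + 1) → Derived G S w ∨ ∃ l ≤ k, f l = w) :
    ∀ k ≤ n, Derived G S (f k) := by
  intro k
  induction k using Nat.strong_induction_on with
  | _ k ih =>
    intro hk
    rcases k with _ | k
    · exact h0
    refine .force _ _ (ih k (by omega) (by omega)) (hadj k hk) fun w hw hne => ?_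
    rcases hn k hk w hw hne with h | ⟨l, hl, rfl⟩
    · exact h
    · exact ih l (by omega) (by omega)

lemma IsPathGraph.exists_isZeroForcing [Nonempty V] (h : IsPathGraph G) :
    ∃ u, IsZeroForcing G {u} := by
  obtain ⟨n, ⟨e⟩⟩ := h
  obtain ⟨v⟩ := ‹Nonempty V›
  rcases n with _ | n
  · exact (e v).elim0
  have hp := isInducedPath_pathFun e.symm.toEmbedding
  set f := pathFun e.symm.toEmbedding with hf
  have hcov : ∀ v, ∃ k ≤ n, f k = v := fun v =>
    ⟨e v, by omega, (pathFun_val e.symm.toEmbedding (e v)).trans (e.symm_apply_apply v)⟩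
  refine ⟨f 0, fun v => ?_⟩
  obtain ⟨k, hk, rfl⟩ := hcov v
  refine derived_of_sequence f n (.initial _ (Set.mem_singleton _)) (fun k hk => ?_) (fun k hk w hw hne => ?_) k hk
  · exact (hp.adj k (by omega) (k + 1) (by omega)).2 (.inl rfl)
  · obtain ⟨l, hl, rfl⟩ := hcov w
    rcases (hp.adj k (by omega) l hl).1 hw with rfl | rfl
    · exact absurd rfl hne
    · exact .inr ⟨l, by omega, rfl⟩

lemma IsConnectedForcing.singleton {u : V} (hu : IsZeroForcing G {u}) :
    IsConnectedForcing G {u} := by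
  refine ⟨hu, ?_⟩
  have : Nonempty ({u} : Set V) := ⟨⟨u, rfl⟩⟩
  exact ⟨.of_subsingleton⟩

/-! ### Connected forcing number two and adjacent forcing pairs -/

lemma not_isZeroForcing_singleton (h : connectedForcingNumber G = 2) (u : V) :
    ¬ IsZeroForcing G {u} := fun hu => by
  have : connectedForcingNumber G ≤ ({u} : Set V).encard :=
    iInf_le (fun S : {S : Set V // IsConnectedForcing G S} => S.1.encard) ⟨{u}, .singleton hu⟩
  rw [h, Set.encard_singleton] at this
  exact absurd this (by decide)

lemma exists_adj_isZeroForcing (h : connectedForcingNumber G = 2) :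
    ∃ u v, G.Adj u v ∧ IsZeroForcing G {u, v} := by
  have hne : Nonempty {S : Set V // IsConnectedForcing G S} := by
    by_contra hemp
    rw [not_nonempty_iff] at hemp
    rw [connectedForcingNumber, iInf_of_empty] at h
    exact absurd h (by decide)
  obtain ⟨⟨S, hS⟩, hcard⟩ :=
    csInf_mem (Set.range_nonempty fun S : {S : Set V // IsConnectedForcing G S} => S.1.encard)
  have h2 : S.encard = 2 := hcard.trans h
  obtain ⟨u, v, huv, rfl⟩ := Set.encard_eq_two.1 h2
  refine ⟨u, v, ?_, hS.1⟩
  obtain ⟨p⟩ := hS.2.preconnected ⟨u, .inl rfl⟩ ⟨v, .inr rfl⟩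
  have hadj : G.Adj u p.snd.1 :=
    p.adj_snd (SimpleGraph.Walk.not_nil_of_ne fun heq => huv (congrArg Subtype.val heq))
  generalize p.snd = x at hadj
  obtain ⟨w, hw⟩ := x
  rcases hw with rfl | rfl
  · exact absurd hadj (by simp)
  · exact hadj

lemma connectedForcingNumber_eq_two [Finite V] (hp : ¬ IsPathGraph G) {u v : V}
    (huv : G.Adj u v) (hf : IsZeroForcing G {u, v}) : connectedForcingNumber G = 2 := by
  refine le_antisymm ?_ (le_iInf fun ⟨S, hS⟩ => ?_)
  · rw [← Set.encard_pair huv.ne]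
    refine iInf_le (fun S : {S : Set V // IsConnectedForcing G S} => S.1.encard) ⟨{u, v}, hf, ?_⟩
    exact SimpleGraph.induce_pair_connected_of_adj huv
  · by_contra hlt
    have h1 : S.encard ≤ 1 := by
      rw [not_le] at hlt
      exact Order.le_of_lt_succ (by simpa [one_add_one_eq_two] using hlt)
    obtain ⟨⟨u, hu⟩⟩ := hS.2.nonempty
    obtain rfl : S = {u} := (Set.encard_le_one_iff_subsingleton.1 h1).eq_singleton_of_mem hu
    exact hp hS.1.isPathGraph

/-! ### Pairs of forcing chains -/

/-- A pair of disjoint forcing chains between which the edges do not cross. -/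
structure IsForcingPair (G : SimpleGraph V) (a b : ℕ → V) (s t : ℕ) (C : Set V) : Prop where
  left : IsForcingChain G a s C
  right : IsForcingChain G b t C
  disjoint : ∀ k ≤ s, ∀ l ≤ t, a k ≠ b l
  cover : ∀ v ∈ C, (∃ k ≤ s, a k = v) ∨ ∃ l ≤ t, b l = v
  cross : ∀ k ≤ s, ∀ l ≤ t, ∀ k' ≤ s, ∀ l' ≤ t,
    G.Adj (a k) (b l) → G.Adj (a k') (b l') → k < k' → l ≤ l'

namespace IsForcingPair

variable {a b : ℕ → V} {s t : ℕ} {C : Set V}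

lemma symm (h : IsForcingPair G a b s t C) : IsForcingPair G b a t s C where
  left := h.right
  right := h.left
  disjoint k hk l hl := (h.disjoint l hl k hk).symm
  cover v hv := (h.cover v hv).symm
  cross l hl k hk l' hl' k' hk' hkl hkl' hlt := by
    by_contra hcon
    exact absurd (h.cross k' hk' l' hl' k hk l hl hkl'.symm hkl.symm (by omega)) (by omega)

/-- The vertices of `b` before `b t` have all their neighbours in `C`, so `b t` is the only possible
neighbour of `w` on the other chain: no new edge can cross an old one. -/
lemma update (h : IsForcingPair G a b s t C) {w : V} (hw : w ∉ C) (haw : G.Adj (a s) w)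
    (hn : ∀ x, G.Adj (a s) x → x ≠ w → x ∈ C) :
    IsForcingPair G (Function.update a (s + 1) w) b (s + 1) t (insert w C) := by
  have hlt : ∀ k, k ≤ s → Function.update a (s + 1) w k = a k := fun k hk =>
    Function.update_of_ne (by omega) _ _
  have hself : Function.update a (s + 1) w (s + 1) = w := Function.update_self _ _ _
  refine ⟨h.left.update hw haw hn, h.right.mono (Set.subset_insert _ _), fun k hk l hl => ?_,
    ?_, fun k hk l hl k' hk' l' hl' hkl hkl' hkk => ?_⟩
  · rcases Nat.le_succ_iff.1 hk with hk | rfl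
    · rw [hlt k hk]
      exact h.disjoint k hk l hl
    · rw [hself]
      rintro rfl
      exact hw (h.right.mem l hl)
  · rintro v (rfl | hv)
    · exact .inl ⟨s + 1, le_rfl, hself⟩
    · rcases h.cover v hv with ⟨k, hk, rfl⟩ | hl
      · exact .inl ⟨k, by omega, hlt k hk⟩
      · exact .inr hl
  · rw [hlt k (by omega)] at hkl
    rcases Nat.le_succ_iff.1 hk' with hk' | rfl
    · rw [hlt k' hk'] at hkl'
      exact h.cross k (by omega) l hl k' hk' l' hl' hkl hkl' hkk
    · rw [hself] at hkl'
      by_contra hcon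
      exact hw (h.right.nbr l' (by omega) w hkl'.symm)

end IsForcingPair

lemma exists_isForcingPair [Finite V] {u v : V} (huv : u ≠ v) (hf : IsZeroForcing G {u, v}) :
    ∃ a b s t, IsForcingPair G a b s t Set.univ ∧ a 0 = u ∧ b 0 = v := by
  suffices H : ∀ n, ∀ (a b : ℕ → V) (s t : ℕ) (C : Set V), Cᶜ.ncard = n →
      IsForcingPair G a b s t C → a 0 = u → b 0 = v →
      ∃ a b s t, IsForcingPair G a b s t Set.univ ∧ a 0 = u ∧ b 0 = v by
    refine H _ (fun _ => u) (fun _ => v) 0 0 {u, v} rfl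
      ⟨.const u (.inl rfl), .const v (.inr rfl), fun _ _ _ _ => huv, ?_, by intros; omega⟩ rfl rfl
    rintro w (rfl | rfl)
    · exact .inl ⟨0, le_rfl, rfl⟩
    · exact .inr ⟨0, le_rfl, rfl⟩
  intro n
  induction n using Nat.strong_induction_on with
  | _ n ih =>
    intro a b s t C hn hc ha hb
    by_cases hC : ∀ v, v ∈ C
    · obtain rfl : C = Set.univ := Set.eq_univ_of_forall hC
      exact ⟨a, b, s, t, hc, ha, hb⟩
    push Not at hC
    obtain ⟨y, hy⟩ := hC
    have hsub : {u, v} ⊆ C := by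
      rintro w (rfl | rfl)
      · exact ha ▸ hc.left.mem 0 (by omega)
      · exact hb ▸ hc.right.mem 0 (by omega)
    obtain ⟨x, hx, w, hw, hxw, hn'⟩ := hf.exists_force hsub hy
    have hcard : (insert w C)ᶜ.ncard < n := by
      rw [← hn]
      refine Set.ncard_lt_ncard ⟨fun y hy hyC => hy (Or.inr hyC), fun h => ?_⟩ (Set.toFinite _)
      exact h hw (Or.inl rfl)
    rcases hc.cover x hx with ⟨k, hk, rfl⟩ | ⟨k, hk, rfl⟩
    · obtain rfl : k = s := by
        by_contra hks
        exact hw (hc.left.nbr k (by omega) w hxw)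
      exact ih _ hcard _ _ _ _ _ rfl (hc.update hw hxw hn')
        ((Function.update_of_ne (by omega) _ _).trans ha) hb
    · obtain rfl : k = t := by
        by_contra hks
        exact hw (hc.right.nbr k (by omega) w hxw)
      exact ih _ hcard _ _ _ _ _ rfl (hc.symm.update hw hxw hn').symm ha
        ((Function.update_of_ne (by omega) _ _).trans hb)

/-! ### Chains and straight-line drawings -/

/-- Segments between two parallel lines whose end points are weakly ordered in the same way, and
not all equal, have disjoint interiors. -/
lemma disjoint_openSegment {x x' y y' : ℝ} (hx : x ≤ x') (hy : y ≤ y') (h : x < x' ∨ y < y') :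
    Disjoint (openSegment ℝ ((x, 0) : ℝ × ℝ) (y, 1)) (openSegment ℝ ((x', 0) : ℝ × ℝ) (y', 1)) := by
  rw [Set.disjoint_left]
  rintro z ⟨c, d, hc, hd, hcd, rfl⟩ ⟨c', d', hc', hd', hcd', heq⟩
  simp only [Prod.smul_mk, Prod.mk_add_mk, smul_eq_mul, Prod.mk.injEq] at heq
  obtain ⟨h1, h2⟩ := heq
  obtain rfl : d' = d := by linarith
  obtain rfl : c' = c := by linarith
  rcases h with h | h
  · nlinarith [mul_lt_mul_of_pos_left h hc, mul_le_mul_of_nonneg_left hy hd.le]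
  · nlinarith [mul_le_mul_of_nonneg_left hx hc.le, mul_lt_mul_of_pos_left h hd]

lemma not_disjoint_openSegment {x x' y y' : ℝ} (hx : x < x') (hy : y' < y) :
    ¬ Disjoint (openSegment ℝ ((x, 0) : ℝ × ℝ) (y, 1))
      (openSegment ℝ ((x', 0) : ℝ × ℝ) (y', 1)) := by
  have hX : 0 < x' - x := sub_pos.2 hx
  have hY : 0 < y - y' := sub_pos.2 hy
  have hS : 0 < (x' - x) + (y - y') := add_pos hX hY
  -- By similar triangles, the crossing point divides both segments in the ratio of `x' - x` to `y -
  -- y'`; these quotients are its weights.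
  have hsum : (y - y') / ((x' - x) + (y - y')) + (x' - x) / ((x' - x) + (y - y')) = 1 := by
    field_simp
    ring
  rw [Set.not_disjoint_iff]
  refine ⟨_, ⟨_, _, div_pos hY hS, div_pos hX hS, hsum, rfl⟩,
    ⟨_, _, div_pos hY hS, div_pos hX hS, hsum, ?_⟩⟩
  ext
  · simp
    field_simp
    ring
  · simp

/-- The drawing given by a pair of forcing chains covering the graph. -/
def IsForcingPair.drawing {a b : ℕ → V} {s t : ℕ} (h : IsForcingPair G a b s t Set.univ) :
    StandardDrawing G where
  p := s
  q := t
  P := h.left.embedding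
  Q := h.right.embedding
  partition := by
    constructor
    · rw [Set.disjoint_left]
      rintro _ ⟨k, rfl⟩ ⟨l, hl⟩
      exact h.disjoint k (by omega) l (by omega) hl.symm
    · rw [codisjoint_iff_le_sup]
      intro v _
      rcases h.cover v trivial with ⟨k, hk, rfl⟩ | ⟨l, hl, rfl⟩
      · exact .inl ⟨⟨k, by omega⟩, rfl⟩
      · exact .inr ⟨⟨l, by omega⟩, rfl⟩
  x i := (i : ℕ)
  y j := (j : ℕ)
  x_strictMono i j hij := Nat.cast_lt.2 hij
  y_strictMono i j hij := Nat.cast_lt.2 hij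
  noncrossing i i' j j' hij hij' hne := by
    have hi := i.is_le
    have hi' := i'.is_le
    have hj := j.is_le
    have hj' := j'.is_le
    have h1 := h.cross i hi j hj i' hi' j' hj' hij hij'
    have h2 := h.cross i' hi' j' hj' i hi j hj hij' hij
    have hne' : (i : ℕ) ≠ i' ∨ (j : ℕ) ≠ j' := by
      by_contra! hcon
      exact hne (Prod.ext (Fin.ext hcon.1) (Fin.ext hcon.2))
    -- Noncrossing says that any two cross edges are comparable in the product order.
    have key : ((i : ℕ) ≤ i' ∧ (j : ℕ) ≤ j' ∧ ((i : ℕ) < i' ∨ (j : ℕ) < j')) ∨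
        ((i' : ℕ) ≤ i ∧ (j' : ℕ) ≤ j ∧ ((i' : ℕ) < i ∨ (j' : ℕ) < j)) := by omega
    rcases key with ⟨h3, h4, h5⟩ | ⟨h3, h4, h5⟩
    · exact disjoint_openSegment (by exact_mod_cast h3) (by exact_mod_cast h4)
        (by exact_mod_cast h5)
    · exact (disjoint_openSegment (by exact_mod_cast h3) (by exact_mod_cast h4)
        (by exact_mod_cast h5)).symm

/-! ### Zero forcing in a standard drawing -/

namespace StandardDrawing

variable (D : StandardDrawing G)

lemma cross_le {i i' : Fin (D.p + 1)} {j j' : Fin (D.q + 1)} (h : G.Adj (D.P i) (D.Q j))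
    (h' : G.Adj (D.P i') (D.Q j')) (hi : i < i') : j ≤ j' := by
  by_contra! hj
  exact not_disjoint_openSegment (D.x_strictMono hi) (D.y_strictMono hj)
    (D.noncrossing i i' j j' h h' fun heq => hi.ne (Prod.ext_iff.1 heq).1)

lemma cover (v : V) : (∃ i, D.P i = v) ∨ ∃ j, D.Q j = v :=
  codisjoint_iff_le_sup.1 D.partition.codisjoint (Set.mem_univ v)

lemma P_ne_Q (i : Fin (D.p + 1)) (j : Fin (D.q + 1)) : D.P i ≠ D.Q j := fun h =>
  Set.disjoint_left.1 D.partition.disjoint ⟨i, rfl⟩ ⟨j, h.symm⟩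

lemma P_adj {i j : Fin (D.p + 1)} :
    G.Adj (D.P i) (D.P j) ↔ i.val + 1 = j.val ∨ j.val + 1 = i.val := by
  rw [D.P.map_adj_iff, SimpleGraph.pathGraph_adj]

lemma Q_adj {i j : Fin (D.q + 1)} :
    G.Adj (D.Q i) (D.Q j) ↔ i.val + 1 = j.val ∨ j.val + 1 = i.val := by
  rw [D.Q.map_adj_iff, SimpleGraph.pathGraph_adj]

/-- The drawing with the two paths exchanged. -/
def swap : StandardDrawing G where
  p := D.q
  q := D.p
  P := D.Q
  Q := D.P
  partition := D.partition.symm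
  x := D.y
  y := D.x
  x_strictMono := D.y_strictMono
  y_strictMono := D.x_strictMono
  noncrossing i i' j j' h h' hne := by
    -- Reflection in the line halfway between the two paths.
    have hflip : ∀ x y : ℝ, ∀ z ∈ openSegment ℝ ((x, 0) : ℝ × ℝ) (y, 1),
        ((z.1, 1 - z.2) : ℝ × ℝ) ∈ openSegment ℝ ((y, 0) : ℝ × ℝ) (x, 1) := by
      rintro x y z ⟨c, d, hc, hd, hcd, rfl⟩
      refine ⟨d, c, hd, hc, by linarith, ?_⟩
      ext
      · simp [add_comm]
      · simp
        linarith
    rw [Set.disjoint_left]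
    intro z hz hz'
    refine Set.disjoint_left.1 (D.noncrossing j j' i i' h.symm h'.symm fun heq => hne ?_)
      (hflip _ _ z hz) (hflip _ _ z hz')
    rw [Prod.mk.injEq] at heq ⊢
    exact heq.symm

/-- Coloured initial segments grow greedily. If neither front vertex can force, each has a neighbour
beyond the other front, and these two edges cross. -/
lemma isZeroForcing_first : IsZeroForcing G {D.P 0, D.Q 0} := by
  have H : ∀ n ≤ D.p + D.q, ∃ s ≤ D.p, ∃ t ≤ D.q, s + t = n ∧
      (∀ i, i.val ≤ s → Derived G {D.P 0, D.Q 0} (D.P i)) ∧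
      ∀ j, j.val ≤ t → Derived G {D.P 0, D.Q 0} (D.Q j) := by
    intro n
    induction n with
    | zero =>
      refine fun _ => ⟨0, by omega, 0, by omega, rfl, fun i hi => .initial _ (.inl ?_),
        fun j hj => .initial _ (.inr ?_)⟩
      · rw [show i = 0 from Fin.ext (by simpa using hi)]
      · rw [show j = 0 from Fin.ext (by simpa using hj)]
        rfl
    | succ n ih =>
      intro hn
      obtain ⟨s, hs, t, ht, hst, hP, hQ⟩ := ih (by omega)
      by_cases hA : s < D.p ∧ ∀ j, G.Adj (D.P ⟨s, by omega⟩) (D.Q j) → j.val ≤ t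
      · obtain ⟨hs', hA⟩ := hA
        refine ⟨s + 1, hs', t, ht, by omega, fun i hi => ?_, hQ⟩
        rcases Nat.le_succ_iff.1 hi with hi | hi
        · exact hP i hi
        refine .force _ _ (hP ⟨s, by omega⟩ le_rfl) (D.P_adj.2 (.inl hi.symm)) fun w hw hne => ?_
        rcases D.cover w with ⟨k, rfl⟩ | ⟨l, rfl⟩
        · rcases D.P_adj.1 hw with hk | hk
          · exact absurd (congrArg D.P (Fin.ext (hk.symm.trans hi.symm))) hne
          · exact hP k (by simp only at hk; omega)
        · exact hQ l (hA l hw)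
      by_cases hB : t < D.q ∧ ∀ i, G.Adj (D.P i) (D.Q ⟨t, by omega⟩) → i.val ≤ s
      · obtain ⟨ht', hB⟩ := hB
        refine ⟨s, hs, t + 1, ht', by omega, hP, fun i hi => ?_⟩
        rcases Nat.le_succ_iff.1 hi with hi | hi
        · exact hQ i hi
        refine .force _ _ (hQ ⟨t, by omega⟩ le_rfl) (D.Q_adj.2 (.inl hi.symm)) fun w hw hne => ?_
        rcases D.cover w with ⟨k, rfl⟩ | ⟨l, rfl⟩
        · exact hP k (hB k hw.symm)
        · rcases D.Q_adj.1 hw with hk | hk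
          · exact absurd (congrArg D.Q (Fin.ext (hk.symm.trans hi.symm))) hne
          · exact hQ l (by simp only at hk; omega)
      exfalso
      rcases Nat.lt_or_ge s D.p with hs' | hs'
      · push Not at hA
        obtain ⟨j, hj, hjt⟩ := hA hs'
        push Not at hB
        obtain ⟨i, hi, his⟩ := hB (by omega)
        have := D.cross_le hj hi his
        exact absurd (Fin.le_def.1 this) (by simp only; omega)
      -- With `P` exhausted, `s + t < p + q` leaves `t < q`, and the front of `Q` has no uncoloured
      -- neighbour on `P`.
      · exact hB ⟨by omega, fun i _ => by omega⟩
  obtain ⟨s, hs, t, ht, hst, hP, hQ⟩ := H _ le_rfl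
  intro v
  rcases D.cover v with ⟨i, rfl⟩ | ⟨j, rfl⟩
  · exact hP i (by omega)
  · exact hQ j (by omega)

/-- Since `P i'` is coloured, forcing runs backwards along `Q` down to `Q 0`, which then forces `P
i`. With `Q` coloured, it spreads outwards along `P` from `P i` and `P i'`. -/
lemma isZeroForcing_second {i i' : Fin (D.p + 1)} (hii : i'.val = i.val + 1)
    (h0 : G.Adj (D.P i) (D.Q 0))
    (hcross : ∀ k l, G.Adj (D.P k) (D.Q l) → (k = i ∧ l = 0) ∨ k = i') :
    IsZeroForcing G {D.P i', D.Q (Fin.last D.q)} := by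
  have hi' : Derived G {D.P i', D.Q (Fin.last D.q)} (D.P i') := .initial _ (.inl rfl)
  have hQn : ∀ n ≤ D.q, Derived G {D.P i', D.Q (Fin.last D.q)} (D.Q ⟨D.q - n, by omega⟩) := by
    refine derived_of_sequence (fun n => D.Q ⟨D.q - n, by omega⟩) D.q (.initial _ (.inr rfl))
      (fun k hk => D.Q_adj.2 (by simp only; omega)) fun k hk w hw hne => ?_
    rcases D.cover w with ⟨m, rfl⟩ | ⟨l, rfl⟩
    · rcases hcross _ _ hw.symm with ⟨-, hl⟩ | rfl
      · have := Fin.val_eq_of_eq hl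
        simp at this
        omega
      · exact .inl hi'
    · have hl := D.Q_adj.1 hw
      simp only at hl
      refine .inr ⟨D.q - l, ?_, congrArg D.Q (Fin.ext (by simp only; omega))⟩
      by_contra hlt
      exact hne (congrArg D.Q (Fin.ext (by simp only; omega)))
  have hQ : ∀ l, Derived G {D.P i', D.Q (Fin.last D.q)} (D.Q l) := fun l => by
    convert hQn (D.q - l) (by omega) using 3
    omega
  have hi : Derived G {D.P i', D.Q (Fin.last D.q)} (D.P i) := by
    refine .force _ _ (hQ 0) h0.symm fun w hw hne => ?_
    rcases D.cover w with ⟨m, rfl⟩ | ⟨l, rfl⟩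
    · rcases hcross _ _ hw.symm with ⟨rfl, -⟩ | rfl
      · exact absurd rfl hne
      · exact hi'
    · exact hQ l
  have hlo : ∀ n ≤ i.val, Derived G {D.P i', D.Q (Fin.last D.q)} (D.P ⟨i - n, by omega⟩) := by
    refine derived_of_sequence (fun n => D.P ⟨i - n, by omega⟩) i hi
      (fun k hk => D.P_adj.2 (by simp only; omega)) fun k hk w hw hne => ?_
    rcases D.cover w with ⟨m, rfl⟩ | ⟨l, rfl⟩
    · have hm := D.P_adj.1 hw
      simp only at hm
      by_cases hmi : m = i'
      · exact .inl (hmi ▸ hi')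
      have hmi' : m.val ≠ i'.val := fun h => hmi (Fin.ext h)
      refine .inr ⟨i - m, ?_, congrArg D.P (Fin.ext (by simp only; omega))⟩
      by_contra hlt
      exact hne (congrArg D.P (Fin.ext (by simp only; omega)))
    · exact .inl (hQ l)
  -- The minimum only keeps the index in range.
  have hhi : ∀ n ≤ D.p - i', Derived G {D.P i', D.Q (Fin.last D.q)}
      (D.P ⟨min (i' + n) D.p, by omega⟩) := by
    refine derived_of_sequence (fun n => D.P ⟨min (i' + n) D.p, by omega⟩) (D.p - i') ?_
      (fun k hk => D.P_adj.2 (by simp only; omega)) fun k hk w hw hne => ?_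
    · convert hi' using 2
      exact Fin.ext (by simp only; omega)
    rcases D.cover w with ⟨m, rfl⟩ | ⟨l, rfl⟩
    · have hm := D.P_adj.1 hw
      simp only at hm
      by_cases hmi : m = i
      · exact .inl (hmi ▸ hi)
      have hmi' : m.val ≠ i.val := fun h => hmi (Fin.ext h)
      refine .inr ⟨m - i', ?_, congrArg D.P (Fin.ext (by simp only; omega))⟩
      by_contra hlt
      exact hne (congrArg D.P (Fin.ext (by simp only; omega)))
    · exact .inl (hQ l)
  intro v
  rcases D.cover v with ⟨k, rfl⟩ | ⟨l, rfl⟩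
  · rcases Nat.lt_or_ge i.val k.val with hk | hk
    · convert hhi (k - i') (by omega) using 2
      exact Fin.ext (by simp only; omega)
    · convert hlo (i - k) (by omega) using 2
      exact Fin.ext (by simp only; omega)
  · exact hQ l

/-- If the first vertices of the two paths are joined by the only cross edge, then the last vertex
of the first path is a zero forcing set. -/
lemma isZeroForcing_last (h0 : G.Adj (D.P 0) (D.Q 0))
    (hcross : ∀ k l, G.Adj (D.P k) (D.Q l) → k = 0 ∧ l = 0) :
    IsZeroForcing G {D.P (Fin.last D.p)} := by
  have hPn : ∀ n ≤ D.p, Derived G {D.P (Fin.last D.p)} (D.P ⟨D.p - n, by omega⟩) := by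
    refine derived_of_sequence (fun n => D.P ⟨D.p - n, by omega⟩) D.p (.initial _ rfl)
      (fun k hk => D.P_adj.2 (by simp only; omega)) fun k hk w hw hne => ?_
    rcases D.cover w with ⟨m, rfl⟩ | ⟨l, rfl⟩
    · have hm := D.P_adj.1 hw
      simp only at hm
      refine .inr ⟨D.p - m, ?_, congrArg D.P (Fin.ext (by simp only; omega))⟩
      by_contra hlt
      exact hne (congrArg D.P (Fin.ext (by simp only; omega)))
    · have := Fin.val_eq_of_eq (hcross _ _ hw).1
      simp at this
      omega
  have hP : ∀ k, Derived G {D.P (Fin.last D.p)} (D.P k) := fun k => by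
    convert hPn (D.p - k) (by omega) using 3
    omega
  have hQ0 : Derived G {D.P (Fin.last D.p)} (D.Q 0) := by
    refine .force _ _ (hP 0) h0 fun w hw hne => ?_
    rcases D.cover w with ⟨m, rfl⟩ | ⟨l, rfl⟩
    · exact hP m
    · exact absurd (congrArg D.Q (hcross _ _ hw).2) hne
  have hQn : ∀ n ≤ D.q, Derived G {D.P (Fin.last D.p)} (D.Q ⟨min n D.q, by omega⟩) := by
    refine derived_of_sequence (fun n => D.Q ⟨min n D.q, by omega⟩) D.q ?_
      (fun k hk => D.Q_adj.2 (by simp only; omega)) fun k hk w hw hne => ?_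
    · convert hQ0 using 2
      exact Fin.ext (by simp)
    rcases D.cover w with ⟨m, rfl⟩ | ⟨l, rfl⟩
    · exact .inl (hP m)
    · have hl := D.Q_adj.1 hw
      simp only at hl
      refine .inr ⟨l, ?_, congrArg D.Q (Fin.ext (by simp only; omega))⟩
      by_contra hlt
      exact hne (congrArg D.Q (Fin.ext (by simp only; omega)))
  intro v
  rcases D.cover v with ⟨k, rfl⟩ | ⟨l, rfl⟩
  · exact hP k
  · convert hQn l (by omega) using 2
    exact Fin.ext (by simp only; omega)

/-- A vertex of `P` before the last has its successor and a second neighbour: its predecessor or,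
for `P 0`, the vertex `Q 0`. -/
lemma eq_last_of_isLeaf (h0 : G.Adj (D.P 0) (D.Q 0)) {k : Fin (D.p + 1)}
    (hk : IsLeaf G (D.P k)) : k = Fin.last D.p := by
  by_contra hne
  have hlt : k.val < D.p := by
    have : k.val ≠ D.p := fun h => hne (Fin.ext h)
    omega
  have hnext : G.Adj (D.P k) (D.P ⟨k + 1, by omega⟩) := D.P_adj.2 (.inl rfl)
  rcases Nat.eq_zero_or_pos k.val with hz | hpos
  · obtain rfl : k = 0 := Fin.ext hz
    exact D.P_ne_Q _ _ (hk.unique hnext h0)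
  · have hprev : G.Adj (D.P k) (D.P ⟨k - 1, by omega⟩) := D.P_adj.2 (.inr (by simp only; omega))
    have := Fin.val_eq_of_eq (D.P.injective (hk.unique hnext hprev))
    simp only at this
    omega

end StandardDrawing

/-! ### The characterization -/

lemma inFirstFamily_of_connectedForcingNumber_eq_two [Finite V]
    (h : connectedForcingNumber G = 2) : InFirstFamily G := by
  obtain ⟨u, v, huv, hf⟩ := exists_adj_isZeroForcing h
  have : Nonempty V := ⟨u⟩
  have hnp : ¬ IsPathGraph G := fun hp => by
    obtain ⟨w, hw⟩ := hp.exists_isZeroForcing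
    exact not_isZeroForcing_singleton h w hw
  obtain ⟨a, b, s, t, hpair, rfl, rfl⟩ := exists_isForcingPair huv.ne hf
  obtain ⟨D, h0⟩ : ∃ D : StandardDrawing G, G.Adj (D.P 0) (D.Q 0) := ⟨hpair.drawing, huv⟩
  have : Nonempty {e : Fin (D.p + 1) × Fin (D.q + 1) // G.Adj (D.P e.1) (D.Q e.2)} :=
    ⟨⟨(0, 0), h0⟩⟩
  -- As cross edges are pairwise comparable, one with maximal index sum dominates all others in both
  -- coordinates.
  obtain ⟨⟨⟨i, j⟩, hij⟩, hmax⟩ := Finite.exists_max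
    fun e : {e : Fin (D.p + 1) × Fin (D.q + 1) // G.Adj (D.P e.1) (D.Q e.2)} =>
      e.1.1.val + e.1.2.val
  have hle : ∀ k l, G.Adj (D.P k) (D.Q l) → k ≤ i ∧ l ≤ j := by
    intro k l hkl
    have hm : k.val + l.val ≤ i.val + j.val := hmax ⟨(k, l), hkl⟩
    have h1 := D.cross_le hij hkl
    have h2 := D.cross_le hkl hij
    simp only [Fin.le_def, Fin.lt_def] at h1 h2 ⊢
    omega
  refine ⟨⟨hnp, ⟨D⟩⟩, D, i, j, fun w hw => ?_, h0, hij, fun heq => ?_, hle⟩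
  · rcases D.cover w with ⟨k, rfl⟩ | ⟨l, rfl⟩
    · exact .inl (congrArg D.P (D.eq_last_of_isLeaf h0 hw))
    · exact .inr (congrArg D.Q (D.swap.eq_last_of_isLeaf h0.symm hw))
  · obtain ⟨rfl, rfl⟩ := Prod.mk.inj heq
    refine not_isZeroForcing_singleton h _ (D.isZeroForcing_last h0 fun k l hkl => ?_)
    exact (hle k l hkl).imp Fin.le_zero_iff.1 Fin.le_zero_iff.1

end ConnectedForcing

theorem theorem3 {V : Type*} [Finite V] (G : SimpleGraph V) :
    ConnectedForcing.connectedForcingNumber G = 2 ↔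
      ConnectedForcing.InFirstFamily G ∨ ConnectedForcing.InSecondFamily G := by
  constructor
  · exact fun h => .inl (ConnectedForcing.inFirstFamily_of_connectedForcingNumber_eq_two h)
  · rintro (⟨⟨hnp, -⟩, D, i, j, -, h0, -⟩ | ⟨⟨hnp, -⟩, D, i, i', -, hii, h0, hq, hcross⟩)
    · exact ConnectedForcing.connectedForcingNumber_eq_two hnp h0 D.isZeroForcing_first
    · exact ConnectedForcing.connectedForcingNumber_eq_two hnp hq
        (D.isZeroForcing_second hii h0 hcross)
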